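/- Regard $\mathbb{Z}^2$ as the infinite graph in which two lattice points are adjacent when their Euclidean distance is $1$. For a nonempty finite set $G\subset\mathbb{Z}^2$, regarded as an induced subgraph with $|G|$ vertices, let $A$ be its adjacency matrix and let $\lambda_D(G)$ be the smallest eigenvalue of its Dirichlet Laplacian $L_D = 4I - A$. For $n\ge 1$ put $$\lambda_D^{(n)} = \inf\{\lambda_D(H) : H\subset\mathbb{Z}^2,\ |H| = n\},$$ and call $G$ a minimizing subgraph if $\lambda_D(G)=\lambda_D^{(|G|)}$. Let $\mathbf{G}\subset\mathbb{R}^2$ be the interior of the union of the closed unit squares (with sides parallel to the coordinate axes) centred at the points of $G$. If $G$ is a minimizing subgraph, then $\mathbf{G}$ is simply connected (that is, it is nonempty and path-connected, and every loop in it is null-homotopic in it). -/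

import Mathlib

/-- The square lattice graph `ℤ²`: two lattice points are joined by an edge exactly when they are
at `ℓ¹`-distance one. -/
def squareLattice : SimpleGraph (ℤ × ℤ) where
  Adj p q := |p.1 - q.1| + |p.2 - q.2| = 1
  symm := ⟨fun p q h => by rw [abs_sub_comm q.1 p.1, abs_sub_comm q.2 p.2]; exact h⟩
  loopless := ⟨fun p h => by simp at h⟩

instance : DecidableRel squareLattice.Adj :=
  fun p q => inferInstanceAs (Decidable (|p.1 - q.1| + |p.2 - q.2| = 1))

/-- The finite induced subgraph of `ℤ²` with vertex set `G`.  Finite induced subgraphs are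
determined by their vertex sets, so they are represented by finite sets of lattice points. -/
abbrev latticeSubgraph (G : Finset (ℤ × ℤ)) : SimpleGraph G :=
  squareLattice.comap Subtype.val

/-- The combinatorial Dirichlet Laplacian `L_D = 4 I - A` of the induced subgraph on `G`, where `A`
is its adjacency matrix. -/
def dirichletLaplacian (G : Finset (ℤ × ℤ)) : Matrix G G ℝ :=
  (4 : ℝ) • (1 : Matrix G G ℝ) - (latticeSubgraph G).adjMatrix ℝ

/-- The lowest eigenvalue `λ_D(G)` of the Dirichlet Laplacian.  For nonempty `G` the set below is
finite and nonempty (the matrix is real symmetric), so the infimum is a minimum. -/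
noncomputable def lamD (G : Finset (ℤ × ℤ)) : ℝ :=
  sInf {μ : ℝ | Module.End.HasEigenvalue (Matrix.toLin' (dirichletLaplacian G)) μ}

/-- `λ_D^{(n)}`: the infimum of `λ_D(G)` over all induced subgraphs of `ℤ²` with `n` vertices. -/
noncomputable def lamDInf (n : ℕ) : ℝ :=
  sInf {r : ℝ | ∃ G : Finset (ℤ × ℤ), G.card = n ∧ lamD G = r}

/-- `G` is a minimizing subgraph: it attains the infimum of `λ_D` among the induced subgraphs with
the same number of vertices. -/
def IsMinimizingSubgraph (G : Finset (ℤ × ℤ)) : Prop :=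
  lamD G = lamDInf G.card

/-- The closed unit square in the plane centred at a lattice point, with sides parallel to the
axes. -/
def unitSquare (v : ℤ × ℤ) : Set (ℝ × ℝ) :=
  Set.Icc ((v.1 : ℝ) - 1 / 2) (v.1 + 1 / 2) ×ˢ Set.Icc ((v.2 : ℝ) - 1 / 2) (v.2 + 1 / 2)

/-- The planar domain associated with `G`: the interior of the union of the closed unit squares
centred at the vertices of `G`. -/
def associatedDomain (G : Finset (ℤ × ℤ)) : Set (ℝ × ℝ) :=
  interior (⋃ v ∈ G, unitSquare v)

/-! Minimizing the lowest Dirichlet eigenvalue means maximizing the Rayleigh quotient of the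
adjacency matrix, whose maximum on `G` is `4 - lamD G`. Extension by zero makes this number a bound
for every set of at most `G.card` vertices (`IsMinimizingSubgraph.edgeForm_le`).

The bound is never attained by a positive function on a smaller set, since a small value at a new
neighbouring vertex would raise the quotient (`edgeForm_lt_of_card_lt`). Hence a nonnegative
maximizer is positive on all of `G`, and some vertical edge crosses every horizontal line separating
vertices of `G`.

Steiner symmetrization of the superlevel sets preserves the square sum and does not decrease the
edge form; it strictly increases it if a row of `G` has a gap (`exists_edgeForm_lt_steinerSymm`). So
every row is an interval.

The associated domain therefore has convex horizontal slices over an interval of heights, and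
contracts along its slices onto the graph of a continuous section. -/

/-! ### Topology of the planar domain -/

theorem isSimplyConnected_of_convex_slices {U : Set (ℝ × ℝ)} (hU : IsOpen U) (hne : U.Nonempty)
    (hslice : ∀ y, Convex ℝ {x | (x, y) ∈ U}) (hproj : Convex ℝ (Prod.snd '' U)) :
    IsSimplyConnected U := by
  obtain ⟨g, hg⟩ := exists_continuous_forall_mem_convex_of_local_const
    (X := (Prod.snd '' U : Set ℝ)) (E := ℝ) (t := fun y => {x | (x, (y : ℝ)) ∈ U})
    (fun y => hslice y) (by
      rintro ⟨_, ⟨x, y⟩, hxy, rfl⟩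
      -- Since `U` is open, a point of one slice lies in all nearby slices; partitions of unity glue
      -- these local constants into a section.
      refine ⟨x, ?_⟩
      have hc : Continuous fun z : (Prod.snd '' U : Set ℝ) => (x, (z : ℝ)) := by fun_prop
      exact (hU.preimage hc).mem_nhds hxy)
  have hX : ContractibleSpace (Prod.snd '' U : Set ℝ) := hproj.contractibleSpace (hne.image _)
  have hg' : ∀ y : (Prod.snd '' U : Set ℝ), (g y, (y : ℝ)) ∈ U := hg
  let p : C(U, (Prod.snd '' U : Set ℝ)) :=
    ⟨fun u => ⟨u.1.2, u.1, u.2, rfl⟩, by fun_prop⟩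
  let s : C((Prod.snd '' U : Set ℝ), U) := ⟨fun y => ⟨(g y, y), hg' y⟩, by fun_prop⟩
  have hmem : ∀ z : unitInterval × U,
      ((z.1 : ℝ) * z.2.1.1 + (1 - (z.1 : ℝ)) * g (p z.2), z.2.1.2) ∈ U := by
    rintro ⟨t, u⟩
    have hu : u.1.1 ∈ {x | (x, u.1.2) ∈ U} := u.2
    have hs : g (p u) ∈ {x | (x, u.1.2) ∈ U} := hg' (p u)
    exact hslice u.1.2 hu hs t.2.1 (sub_nonneg.2 t.2.2) (by ring)
  let F : ContinuousMap.Homotopy (s.comp p) (ContinuousMap.id U) :=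
    { toFun := fun z => ⟨_, hmem z⟩
      continuous_toFun := by fun_prop
      map_zero_left := by
        intro u
        apply Subtype.ext
        simp [s, p]
      map_one_left := by
        intro u
        apply Subtype.ext
        simp }
  let e : ContinuousMap.HomotopyEquiv U (Prod.snd '' U : Set ℝ) :=
    { toFun := p
      invFun := s
      left_inv := ⟨F⟩
      right_inv := by
        have : p.comp s = ContinuousMap.id _ := by ext y; rfl
        rw [this] }
  have : ContractibleSpace U := e.contractibleSpace
  exact (inferInstance : SimplyConnectedSpace U)

theorem mem_unitSquare {v : ℤ × ℤ} {x y : ℝ} :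
    (x, y) ∈ unitSquare v ↔
      ((v.1 : ℝ) - 1 / 2 ≤ x ∧ x ≤ v.1 + 1 / 2) ∧ ((v.2 : ℝ) - 1 / 2 ≤ y ∧ y ≤ v.2 + 1 / 2) :=
  Iff.rfl

theorem isClosed_iUnion_unitSquare (G : Finset (ℤ × ℤ)) : IsClosed (⋃ v ∈ G, unitSquare v) :=
  G.finite_toSet.isClosed_biUnion fun _ _ => isClosed_Icc.prod isClosed_Icc

/-- Away from the horizontal grid lines, the slices of the union of squares are intervals as soon
as the rows of `G` are. -/
theorem mem_iUnion_unitSquare_of_mem_Icc {G : Finset (ℤ × ℤ)}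
    (hrow : ∀ a b c j : ℤ, (a, j) ∈ G → (b, j) ∈ G → a ≤ c → c ≤ b → (c, j) ∈ G)
    {y : ℝ} (hy : ∀ j : ℤ, y ≠ j + 1 / 2) {x₁ x₂ x : ℝ}
    (h₁ : (x₁, y) ∈ ⋃ v ∈ G, unitSquare v) (h₂ : (x₂, y) ∈ ⋃ v ∈ G, unitSquare v)
    (hx : x ∈ Set.Icc x₁ x₂) : (x, y) ∈ ⋃ v ∈ G, unitSquare v := by
  simp only [Set.mem_iUnion, exists_prop] at *
  obtain ⟨⟨a, j⟩, ha, h₁⟩ := h₁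
  obtain ⟨⟨b, k⟩, hb, h₂⟩ := h₂
  rw [mem_unitSquare] at h₁ h₂
  simp only at h₁ h₂
  obtain rfl : j = k := by
    have h1 : y ≠ (j : ℝ) + 1 / 2 := hy j
    have h2 : y ≠ (k : ℝ) + 1 / 2 := hy k
    have h3 : y < j + 1 / 2 := lt_of_le_of_ne h₁.2.2 h1
    have h4 : y < k + 1 / 2 := lt_of_le_of_ne h₂.2.2 h2
    have h5 : (j : ℝ) < k + 1 := by linarith [h₁.2.1]
    have h6 : (k : ℝ) < j + 1 := by linarith [h₂.2.1]
    have h5' : j < k + 1 := by exact_mod_cast h5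
    have h6' : k < j + 1 := by exact_mod_cast h6
    omega
  obtain ⟨hx1, hx2⟩ := hx
  -- The covering square is in the column nearest to `x`, clamped to `[a, b]`.
  have hr := abs_le.1 (abs_sub_round x)
  by_cases hra : round x < a
  · have : (round x : ℝ) + 1 ≤ a := by exact_mod_cast hra
    exact ⟨(a, j), ha, mem_unitSquare.2 ⟨⟨by simp only; linarith, by simp only; linarith⟩, h₁.2⟩⟩
  by_cases hrb : b < round x
  · have : (b : ℝ) + 1 ≤ round x := by exact_mod_cast hrb
    exact ⟨(b, j), hb, mem_unitSquare.2 ⟨⟨by simp only; linarith, by simp only; linarith⟩, h₁.2⟩⟩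
  exact ⟨(round x, j), hrow a b _ j ha hb (not_lt.1 hra) (not_lt.1 hrb),
    mem_unitSquare.2 ⟨⟨by simp only; linarith, by simp only; linarith⟩, h₁.2⟩⟩

/-- Slices at half-integer heights are reached by density: both endpoints stay in the domain for
heights in a neighbourhood `V`, so the rectangle between them is covered at generic heights, hence
everywhere because the union of squares is closed. -/
theorem convex_slice_associatedDomain {G : Finset (ℤ × ℤ)}
    (hrow : ∀ a b c j : ℤ, (a, j) ∈ G → (b, j) ∈ G → a ≤ c → c ≤ b → (c, j) ∈ G) (y : ℝ) :
    Convex ℝ {x | (x, y) ∈ associatedDomain G} := by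
  apply Set.OrdConnected.convex
  refine ⟨fun x₁ h₁ x₂ h₂ x hx => ?_⟩
  rcases hx.1.eq_or_lt with rfl | hx1
  · exact h₁
  rcases hx.2.eq_or_lt with rfl | hx2
  · exact h₂
  have hnhds : ∀ᶠ y' in nhds y,
      (x₁, y') ∈ associatedDomain G ∧ (x₂, y') ∈ associatedDomain G := by
    have c1 : Continuous fun z : ℝ => (x₁, z) := by fun_prop
    have c2 : Continuous fun z : ℝ => (x₂, z) := by fun_prop
    exact Filter.Eventually.and ((isOpen_interior.preimage c1).mem_nhds h₁)
      ((isOpen_interior.preimage c2).mem_nhds h₂)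
  obtain ⟨V, hV, hVo, hyV⟩ := eventually_nhds_iff.1 hnhds
  have hdense : Dense ((Set.range fun j : ℤ => (j : ℝ) + 1 / 2)ᶜ) :=
    (Set.countable_range _).dense_compl ℝ
  refine mem_interior.2 ⟨Set.Ioo x₁ x₂ ×ˢ V, ?_, isOpen_Ioo.prod hVo, ⟨hx1, hx2⟩, hyV⟩
  refine ((dense_univ.prod hdense).open_subset_closure_inter (isOpen_Ioo.prod hVo)).trans ?_
  refine closure_minimal ?_ (isClosed_iUnion_unitSquare G)
  rintro ⟨x', y'⟩ ⟨⟨hx', hy'⟩, -, hj⟩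
  exact mem_iUnion_unitSquare_of_mem_Icc hrow (fun j h => hj ⟨j, h.symm⟩)
    (interior_subset (hV y' hy').1) (interior_subset (hV y' hy').2) ⟨hx'.1.le, hx'.2.le⟩

/-- Only heights `j + 1/2` need two stacked squares, which `hcol` supplies; at any other height one
nonempty row is enough. -/
theorem convex_snd_image_associatedDomain {G : Finset (ℤ × ℤ)}
    (hcol : ∀ p ∈ G, ∀ q ∈ G, ∀ j, p.2 ≤ j → j < q.2 → ∃ i, (i, j) ∈ G ∧ (i, j + 1) ∈ G) :
    Convex ℝ (Prod.snd '' associatedDomain G) := by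
  apply Set.OrdConnected.convex
  refine ⟨?_⟩
  rintro _ ⟨⟨x₁, y₁⟩, h₁, rfl⟩ _ ⟨⟨x₂, y₂⟩, h₂, rfl⟩ y hy
  rcases hy.1.eq_or_lt with rfl | hy1
  · exact ⟨_, h₁, rfl⟩
  rcases hy.2.eq_or_lt with rfl | hy2
  · exact ⟨_, h₂, rfl⟩
  have h₁ := interior_subset h₁
  have h₂ := interior_subset h₂
  simp only [Set.mem_iUnion, exists_prop] at h₁ h₂
  obtain ⟨⟨a, k⟩, ha, h₁⟩ := h₁
  obtain ⟨⟨b, l⟩, hb, h₂⟩ := h₂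
  rw [mem_unitSquare] at h₁ h₂
  simp only at h₁ h₂ hy1 hy2
  by_cases hhalf : ∃ j : ℤ, y = j + 1 / 2
  · obtain ⟨j, rfl⟩ := hhalf
    have hk : (k : ℝ) < j + 1 := by linarith
    have hl : (j : ℝ) < l := by linarith
    have hk' : k < j + 1 := by exact_mod_cast hk
    obtain ⟨i, hi, hi'⟩ := hcol _ ha _ hb j (by simp only; omega) (by exact_mod_cast hl)
    refine ⟨((i : ℝ), (j : ℝ) + 1 / 2), mem_interior.2
      ⟨Set.Ioo ((i : ℝ) - 1 / 2) (i + 1 / 2) ×ˢ Set.Ioo ((j : ℝ) - 1 / 2) (j + 3 / 2), ?_,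
        isOpen_Ioo.prod isOpen_Ioo, ⟨by simp, by simp⟩, by simp only; linarith,
        by simp only; linarith⟩, rfl⟩
    rintro ⟨x', y'⟩ ⟨⟨hx1, hx2⟩, hy1, hy2⟩
    simp only at hx1 hx2 hy1 hy2
    simp only [Set.mem_iUnion, exists_prop]
    rcases le_total y' (j + 1 / 2) with h | h
    · exact ⟨_, hi, mem_unitSquare.2 ⟨⟨hx1.le, hx2.le⟩, hy1.le, h⟩⟩
    · refine ⟨_, hi', mem_unitSquare.2 ⟨⟨hx1.le, hx2.le⟩, ?_, ?_⟩⟩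
      · push_cast; linarith
      · push_cast; linarith
  · have hr := abs_le.1 (abs_sub_round y)
    have hlt : y < round y + 1 / 2 :=
      lt_of_le_of_ne (by linarith) fun h => hhalf ⟨round y, h⟩
    have hgt : (round y : ℝ) - 1 / 2 < y :=
      lt_of_le_of_ne (by linarith) fun h => hhalf ⟨round y - 1, by push_cast; linarith⟩
    have hk : (k : ℝ) < round y + 1 := by linarith
    have hl : (round y : ℝ) < l + 1 := by linarith
    have hk' : k < round y + 1 := by exact_mod_cast hk
    have hl' : round y < l + 1 := by exact_mod_cast hl
    obtain ⟨i, hi⟩ : ∃ i, (i, round y) ∈ G := by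
      rcases (Int.lt_add_one_iff.1 hl').eq_or_lt with h | h
      · exact ⟨b, h ▸ hb⟩
      · obtain ⟨i, hi, -⟩ := hcol _ ha _ hb (round y) (Int.lt_add_one_iff.1 hk') h
        exact ⟨i, hi⟩
    refine ⟨((i : ℝ), y), mem_interior.2
      ⟨Set.Ioo ((i : ℝ) - 1 / 2) (i + 1 / 2) ×ˢ
        Set.Ioo ((round y : ℝ) - 1 / 2) (round y + 1 / 2), ?_,
        isOpen_Ioo.prod isOpen_Ioo, ⟨by simp, by simp⟩, hgt, hlt⟩, rfl⟩
    rintro ⟨x', y'⟩ ⟨⟨hx1, hx2⟩, hy1, hy2⟩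
    simp only [Set.mem_iUnion, exists_prop]
    exact ⟨_, hi, mem_unitSquare.2 ⟨⟨hx1.le, hx2.le⟩, hy1.le, hy2.le⟩⟩

theorem associatedDomain_nonempty {G : Finset (ℤ × ℤ)} (hG : G.Nonempty) :
    (associatedDomain G).Nonempty := by
  obtain ⟨v, hv⟩ := hG
  refine ⟨((v.1 : ℝ), (v.2 : ℝ)), interior_mono (Set.subset_biUnion_of_mem hv) ?_⟩
  rw [unitSquare, interior_prod_eq, interior_Icc, interior_Icc]
  exact ⟨⟨by simp, by simp⟩, by simp, by simp⟩

theorem isSimplyConnected_associatedDomain {G : Finset (ℤ × ℤ)} (hne : G.Nonempty)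
    (hrow : ∀ a b c j : ℤ, (a, j) ∈ G → (b, j) ∈ G → a ≤ c → c ≤ b → (c, j) ∈ G)
    (hcol : ∀ p ∈ G, ∀ q ∈ G, ∀ j, p.2 ≤ j → j < q.2 → ∃ i, (i, j) ∈ G ∧ (i, j + 1) ∈ G) :
    IsSimplyConnected (associatedDomain G) :=
  isSimplyConnected_of_convex_slices isOpen_interior (associatedDomain_nonempty hne)
    (convex_slice_associatedDomain hrow) (convex_snd_image_associatedDomain hcol)

/-! ### Rearrangement of finite sets of integers -/

open Finset in
/-- The number of ordered pairs in `A × B` of integers at distance one. -/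
def consecutivePairs (A B : Finset ℤ) : ℕ := #{i ∈ A | i + 1 ∈ B} + #{i ∈ A | i - 1 ∈ B}

/-- The interval of `n` integers centred at `0` or `-1/2`. -/
noncomputable def centeredInterval (n : ℕ) : Finset ℤ := Finset.Ico (-((n / 2 : ℕ) : ℤ)) (((n + 1) / 2 : ℕ) : ℤ)

theorem card_centeredInterval (n : ℕ) : (centeredInterval n).card = n := by
  rw [centeredInterval, Int.card_Ico]; omega

theorem centeredInterval_mono : Monotone centeredInterval := by
  intro m n h
  apply Finset.Ico_subset_Ico <;> omega

/-- Centred intervals grow alternately on the right and on the left. The truncated deficit `2 - (n -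
m)` counts the sides on which the two intervals share an endpoint, at most two. -/
theorem consecutivePairs_centeredInterval {m n : ℕ} (h : m ≤ n) :
    consecutivePairs (centeredInterval m) (centeredInterval n) = 2 * m - (2 - (n - m)) := by
  have h1 : (centeredInterval m).filter (fun i => i + 1 ∈ centeredInterval n) =
      Finset.Ico (-((m / 2 : ℕ) : ℤ)) (min (((m + 1) / 2 : ℕ) : ℤ) (((n + 1) / 2 : ℕ) - 1)) := by
    ext i
    simp only [centeredInterval, Finset.mem_filter, Finset.mem_Ico]
    omega
  have h2 : (centeredInterval m).filter (fun i => i - 1 ∈ centeredInterval n) =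
      Finset.Ico (max (-((m / 2 : ℕ) : ℤ)) (-((n / 2 : ℕ) : ℤ) + 1)) (((m + 1) / 2 : ℕ) : ℤ) := by
    ext i
    simp only [centeredInterval, Finset.mem_filter, Finset.mem_Ico]
    omega
  rw [consecutivePairs, h1, h2, Int.card_Ico, Int.card_Ico]
  omega

theorem Finset.card_filter_lt_of_exists_not {α : Type*} {s : Finset α} {p : α → Prop}
    [DecidablePred p] (h : ∃ x ∈ s, ¬ p x) : (s.filter p).card < s.card :=
  Finset.card_lt_card (Finset.filter_ssubset.2 h)

/-- At each extreme of `A`, either the outward neighbour is missing from `B` and a pair is lost, or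
it is an element of `B` outside `A`. -/
theorem consecutivePairs_le {A B : Finset ℤ} (h : A ⊆ B) :
    consecutivePairs A B ≤
      consecutivePairs (centeredInterval A.card) (centeredInterval B.card) := by
  have hle := Finset.card_le_card h
  rw [consecutivePairs_centeredInterval hle]
  have f1 := Finset.card_filter_le A (fun i => i + 1 ∈ B)
  have f2 := Finset.card_filter_le A (fun i => i - 1 ∈ B)
  rw [consecutivePairs]
  rcases A.eq_empty_or_nonempty with rfl | hA
  · simp
  have hmax := A.max'_mem hA
  have hmin := A.min'_mem hA
  have g1 : A.max' hA + 1 ∉ B → (A.filter fun i => i + 1 ∈ B).card < A.card := fun h =>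
    Finset.card_filter_lt_of_exists_not ⟨_, hmax, h⟩
  have g2 : A.min' hA - 1 ∉ B → (A.filter fun i => i - 1 ∈ B).card < A.card := fun h =>
    Finset.card_filter_lt_of_exists_not ⟨_, hmin, h⟩
  have n1 : A.max' hA + 1 ∉ A := fun h => by have := A.le_max' _ h; omega
  have n2 : A.min' hA - 1 ∉ A := fun h => by have := A.min'_le _ h; omega
  have hpos := hA.card_pos
  by_cases m1 : A.max' hA + 1 ∈ B <;> by_cases m2 : A.min' hA - 1 ∈ B
  · have hmm : A.min' hA ≤ A.max' hA := A.min'_le _ hmax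
    have : A.card + 2 ≤ B.card := by
      have hsub : insert (A.max' hA + 1) (insert (A.min' hA - 1) A) ⊆ B := by
        simp [Finset.insert_subset_iff, m1, m2, h]
      have := Finset.card_le_card hsub
      rwa [Finset.card_insert_of_notMem, Finset.card_insert_of_notMem n2] at this
      simp only [Finset.mem_insert, not_or]
      exact ⟨by omega, n1⟩
    omega
  · have hc : A.card + 1 ≤ B.card := by
      rw [← Finset.card_insert_of_notMem n1]
      exact Finset.card_le_card (by simp [Finset.insert_subset_iff, m1, h])
    have := g2 m2
    omega
  · have hc : A.card + 1 ≤ B.card := by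
      rw [← Finset.card_insert_of_notMem n2]
      exact Finset.card_le_card (by simp [Finset.insert_subset_iff, m2, h])
    have := g1 m1
    omega
  · have := g1 m1
    have := g2 m2
    omega

/-- Besides the two losses at the extremes, the last element `d` before the gap has no right
neighbour. -/
theorem consecutivePairs_self_lt {A : Finset ℤ} {a b c : ℤ} (ha : a ∈ A) (hb : b ∈ A)
    (hac : a ≤ c) (hcb : c ≤ b) (hc : c ∉ A) :
    consecutivePairs A A <
      consecutivePairs (centeredInterval A.card) (centeredInterval A.card) := by
  rw [consecutivePairs_centeredInterval le_rfl, consecutivePairs]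
  have hA : A.Nonempty := ⟨a, ha⟩
  have hmax := A.max'_mem hA
  have hmin := A.min'_mem hA
  have n1 : A.max' hA + 1 ∉ A := fun h => by have := A.le_max' _ h; omega
  have n2 : A.min' hA - 1 ∉ A := fun h => by have := A.min'_le _ h; omega
  have g2 : (A.filter fun i => i - 1 ∈ A).card < A.card :=
    Finset.card_filter_lt_of_exists_not ⟨_, hmin, n2⟩
  have hne : (A.filter (· < c)).Nonempty :=
    ⟨a, Finset.mem_filter.2 ⟨ha, lt_of_le_of_ne hac fun h => hc (h ▸ ha)⟩⟩
  have hd := Finset.mem_filter.1 ((A.filter (· < c)).max'_mem hne)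
  set d := (A.filter (· < c)).max' hne with hd'
  have hd1 : d + 1 ∉ A := by
    intro h
    have hne : d + 1 ≠ c := fun h' => hc (h' ▸ h)
    have := (A.filter (· < c)).le_max' (d + 1) (Finset.mem_filter.2 ⟨h, by omega⟩)
    omega
  have hdm : d ≠ A.max' hA := by
    have := A.le_max' b hb
    omega
  have g1 : (A.filter fun i => i + 1 ∈ A).card + 2 ≤ A.card := by
    have hsub : insert d (insert (A.max' hA) (A.filter fun i => i + 1 ∈ A)) ⊆ A := by
      simp [Finset.insert_subset_iff, hd.1, hmax]
    have := Finset.card_le_card hsub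
    rwa [Finset.card_insert_of_notMem, Finset.card_insert_of_notMem (by simp [n1])] at this
    simp [hdm, hd1]
  omega

/-! ### Steiner symmetrization and adjacent pairs -/

/-- The `j`-th row of a set of lattice points. -/
def latticeRow (A : Finset (ℤ × ℤ)) (j : ℤ) : Finset ℤ := (A.filter (·.2 = j)).image Prod.fst

@[simp]
theorem mem_latticeRow {A : Finset (ℤ × ℤ)} {i j : ℤ} : i ∈ latticeRow A j ↔ (i, j) ∈ A := by
  simp [latticeRow]

theorem latticeRow_mono {A B : Finset (ℤ × ℤ)} (h : A ⊆ B) (j : ℤ) :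
    latticeRow A j ⊆ latticeRow B j := fun _ hi =>
  mem_latticeRow.2 (h (mem_latticeRow.1 hi))

theorem card_filter_eq_sum_latticeRow {A : Finset (ℤ × ℤ)} {J : Finset ℤ}
    (hJ : ∀ p ∈ A, p.2 ∈ J) (P : ℤ × ℤ → Prop) [DecidablePred P] :
    (A.filter P).card = ∑ j ∈ J, ((latticeRow A j).filter fun i => P (i, j)).card := by
  rw [Finset.card_eq_sum_card_fiberwise (f := Prod.snd) (t := J)
    (fun p hp => hJ p (Finset.mem_filter.1 hp).1)]
  refine Finset.sum_congr rfl fun j _ => ?_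
  refine Finset.card_bij' (fun p _ => p.1) (fun i _ => (i, j)) ?_ ?_ ?_ ?_
  · rintro ⟨i, k⟩ h
    simp only [Finset.mem_filter, mem_latticeRow] at h ⊢
    obtain ⟨h, rfl⟩ := h
    exact h
  · intro i h
    simpa using h
  · rintro ⟨i, k⟩ h
    simp only [Finset.mem_filter] at h
    simp [h.2]
  · simp

theorem card_eq_sum_latticeRow {A : Finset (ℤ × ℤ)} {J : Finset ℤ} (hJ : ∀ p ∈ A, p.2 ∈ J) :
    A.card = ∑ j ∈ J, (latticeRow A j).card := by
  simpa using card_filter_eq_sum_latticeRow hJ (fun _ => True)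

/-- Steiner symmetrization of a finite set of lattice points: every row is replaced by the centred
interval of the same cardinality. -/
noncomputable def steinerSymm (A : Finset (ℤ × ℤ)) : Finset (ℤ × ℤ) :=
  (A.image Prod.snd).biUnion fun j => centeredInterval (latticeRow A j).card ×ˢ {j}

theorem mem_steinerSymm {A : Finset (ℤ × ℤ)} {p : ℤ × ℤ} :
    p ∈ steinerSymm A ↔ p.1 ∈ centeredInterval (latticeRow A p.2).card := by
  obtain ⟨i, j⟩ := p
  simp only [steinerSymm, Finset.mem_biUnion, Finset.mem_product, Finset.mem_singleton,
    Finset.mem_image]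
  constructor
  · rintro ⟨k, -, hi, rfl⟩
    exact hi
  · intro hi
    refine ⟨j, ?_, hi, rfl⟩
    rcases (latticeRow A j).eq_empty_or_nonempty with h | ⟨k, hk⟩
    · simp [h, centeredInterval] at hi
    · exact ⟨(k, j), mem_latticeRow.1 hk, rfl⟩

@[simp]
theorem latticeRow_steinerSymm (A : Finset (ℤ × ℤ)) (j : ℤ) :
    latticeRow (steinerSymm A) j = centeredInterval (latticeRow A j).card := by
  ext i; simp [mem_steinerSymm]

theorem snd_mem_of_mem_steinerSymm {A : Finset (ℤ × ℤ)} {J : Finset ℤ} (hJ : ∀ p ∈ A, p.2 ∈ J) :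
    ∀ p ∈ steinerSymm A, p.2 ∈ J := by
  intro p hp
  simp only [steinerSymm, Finset.mem_biUnion, Finset.mem_product, Finset.mem_singleton,
    Finset.mem_image] at hp
  obtain ⟨j, ⟨q, hq, rfl⟩, -, h⟩ := hp
  exact h ▸ hJ q hq

theorem card_steinerSymm (A : Finset (ℤ × ℤ)) : (steinerSymm A).card = A.card := by
  have hJ : ∀ p ∈ A, p.2 ∈ A.image Prod.snd := fun p hp => Finset.mem_image_of_mem _ hp
  rw [card_eq_sum_latticeRow hJ, card_eq_sum_latticeRow (snd_mem_of_mem_steinerSymm hJ)]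
  simp [card_centeredInterval]

theorem steinerSymm_mono : Monotone steinerSymm := by
  intro A B h p hp
  rw [mem_steinerSymm] at *
  exact centeredInterval_mono (Finset.card_le_card (latticeRow_mono h _)) hp

theorem squareLattice_adj_iff {p q : ℤ × ℤ} : squareLattice.Adj p q ↔
    q = (p.1 + 1, p.2) ∨ q = (p.1 - 1, p.2) ∨ q = (p.1, p.2 + 1) ∨ q = (p.1, p.2 - 1) := by
  obtain ⟨a, b⟩ := p
  obtain ⟨c, d⟩ := q
  change |a - c| + |b - d| = 1 ↔ _
  simp only [Prod.mk.injEq, abs_eq_max_neg]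
  omega

/-- The number of ordered pairs in `A × B` of adjacent lattice points. -/
def adjacentPairs (A B : Finset (ℤ × ℤ)) : ℕ :=
  ∑ p ∈ A, ∑ q ∈ B, if squareLattice.Adj p q then 1 else 0

theorem adjacentPairs_comm (A B : Finset (ℤ × ℤ)) : adjacentPairs A B = adjacentPairs B A := by
  rw [adjacentPairs, Finset.sum_comm]
  simp only [squareLattice.adj_comm]
  rfl

theorem adjacentPairs_eq_sum_latticeRow {A : Finset (ℤ × ℤ)} {J : Finset ℤ}
    (hJ : ∀ p ∈ A, p.2 ∈ J) (B : Finset (ℤ × ℤ)) :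
    adjacentPairs A B = ∑ j ∈ J, (consecutivePairs (latticeRow A j) (latticeRow B j) +
      (latticeRow A j ∩ latticeRow B (j + 1)).card +
      (latticeRow A j ∩ latticeRow B (j - 1)).card) := by
  have key : ∀ p q : ℤ × ℤ, (if squareLattice.Adj p q then 1 else 0) =
      (if q = (p.1 + 1, p.2) then 1 else 0) + (if q = (p.1 - 1, p.2) then 1 else 0) +
      (if q = (p.1, p.2 + 1) then 1 else 0) + (if q = (p.1, p.2 - 1) then 1 else 0) := by
    rintro ⟨a, b⟩ ⟨c, d⟩
    simp only [squareLattice_adj_iff, Prod.mk.injEq]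
    split_ifs <;> omega
  simp only [adjacentPairs, key, Finset.sum_add_distrib, Finset.sum_ite_eq', ← Finset.card_filter,
    consecutivePairs]
  simp only [card_filter_eq_sum_latticeRow hJ, ← mem_latticeRow, Finset.filter_mem_eq_inter]

theorem card_inter_le_card_centeredInterval_inter (A B : Finset ℤ) :
    (A ∩ B).card ≤ (centeredInterval A.card ∩ centeredInterval B.card).card := by
  rcases le_total A.card B.card with h | h
  · rw [Finset.inter_eq_left.2 (centeredInterval_mono h), card_centeredInterval]
    exact Finset.card_le_card Finset.inter_subset_left
  · rw [Finset.inter_eq_right.2 (centeredInterval_mono h), card_centeredInterval]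
    exact Finset.card_le_card Finset.inter_subset_right

/-- Horizontal pairs are compared within rows, vertical ones through intersections of neighbouring
rows. Nested pairs suffice, as superlevel sets are nested. -/
theorem adjacentPairs_le_steinerSymm_of_subset {A B : Finset (ℤ × ℤ)} (h : A ⊆ B) :
    adjacentPairs A B ≤ adjacentPairs (steinerSymm A) (steinerSymm B) := by
  have hJ : ∀ p ∈ A, p.2 ∈ A.image Prod.snd := fun p hp => Finset.mem_image_of_mem _ hp
  rw [adjacentPairs_eq_sum_latticeRow hJ,
    adjacentPairs_eq_sum_latticeRow (snd_mem_of_mem_steinerSymm hJ)]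
  simp only [latticeRow_steinerSymm]
  exact Finset.sum_le_sum fun j _ => add_le_add
    (add_le_add (consecutivePairs_le (latticeRow_mono h _))
      (card_inter_le_card_centeredInterval_inter _ _))
    (card_inter_le_card_centeredInterval_inter _ _)

theorem adjacentPairs_self_lt_steinerSymm {A : Finset (ℤ × ℤ)} {a b c j : ℤ} (ha : (a, j) ∈ A)
    (hb : (b, j) ∈ A) (hac : a ≤ c) (hcb : c ≤ b) (hc : (c, j) ∉ A) :
    adjacentPairs A A < adjacentPairs (steinerSymm A) (steinerSymm A) := by
  have hJ : ∀ p ∈ A, p.2 ∈ A.image Prod.snd := fun p hp => Finset.mem_image_of_mem _ hp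
  rw [adjacentPairs_eq_sum_latticeRow hJ,
    adjacentPairs_eq_sum_latticeRow (snd_mem_of_mem_steinerSymm hJ)]
  simp only [latticeRow_steinerSymm]
  refine Finset.sum_lt_sum (fun k _ => ?_) ⟨j, hJ _ ha, ?_⟩
  · exact add_le_add
      (add_le_add (consecutivePairs_le subset_rfl)
        (card_inter_le_card_centeredInterval_inter _ _))
      (card_inter_le_card_centeredInterval_inter _ _)
  · refine add_lt_add_of_lt_of_le (add_lt_add_of_lt_of_le ?_ ?_) ?_
    · exact consecutivePairs_self_lt (mem_latticeRow.2 ha) (mem_latticeRow.2 hb) hac hcb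
        (mt mem_latticeRow.1 hc)
    · exact card_inter_le_card_centeredInterval_inter _ _
    · exact card_inter_le_card_centeredInterval_inter _ _

/-! ### Layer-cake decomposition of the edge form -/

/-- The quadratic form of the adjacency matrix of the subgraph induced on `S`. -/
noncomputable def edgeForm (S : Finset (ℤ × ℤ)) (f : ℤ × ℤ → ℝ) : ℝ :=
  ∑ p ∈ S, ∑ q ∈ S, (if squareLattice.Adj p q then 1 else 0) * (f p * f q)

/-- The elements of a finite set of positive reals are the partial sums of positive increments. -/
theorem exists_pos_increments (V : Finset ℝ) (hV : ∀ v ∈ V, 0 < v) :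
    ∃ w : ℝ → ℝ, (∀ v ∈ V, 0 < w v) ∧ ∀ x ∈ V, x = ∑ v ∈ V, if v ≤ x then w v else 0 := by
  induction V using Finset.induction_on_max with
  | empty => exact ⟨fun _ => 0, by simp, by simp⟩
  | insert m V hm ih =>
    obtain ⟨w, hw, hsum⟩ := ih fun v hv => hV v (Finset.mem_insert_of_mem hv)
    have hmV : m ∉ V := fun h => lt_irrefl _ (hm m h)
    have hlt : ∑ v ∈ V, w v < m := by
      rcases V.eq_empty_or_nonempty with rfl | hne
      · simpa using hV m (by simp)
      · have h := hsum _ (V.max'_mem hne)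
        rw [Finset.sum_congr rfl fun v hv => if_pos (V.le_max' v hv)] at h
        rw [← h]
        exact hm _ (V.max'_mem hne)
    have hw' : ∀ v ∈ V, Function.update w m (m - ∑ v ∈ V, w v) v = w v := fun v hv =>
      Function.update_of_ne (fun h : v = m => hmV (h ▸ hv)) _ _
    -- The new weight is the distance from `m` to the previous maximum, or to `0` if there is none.
    refine ⟨Function.update w m (m - ∑ v ∈ V, w v), ?_, ?_⟩
    · intro v hv
      rcases Finset.mem_insert.1 hv with rfl | hv
      · simpa using hlt
      · rw [hw' v hv]; exact hw v hv
    · intro x hx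
      rw [Finset.sum_insert hmV]
      rcases Finset.mem_insert.1 hx with rfl | hx
      · rw [Finset.sum_congr rfl fun v hv => if_pos (hm v hv).le, Finset.sum_congr rfl hw']
        simp
      · rw [if_neg (not_le.2 (hm x hx)), zero_add]
        conv_lhs => rw [hsum x hx]
        exact Finset.sum_congr rfl fun v hv => by rw [hw' v hv]

section Layers

variable {α : Type*} [DecidableEq α]

/-- A combination of indicator functions with weights `w`. -/
noncomputable def layerSum (V : Finset ℝ) (w : ℝ → ℝ) (A : ℝ → Finset α) (p : α) : ℝ :=
  ∑ v ∈ V, if p ∈ A v then w v else 0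

theorem sum_mul_layerSum {S : Finset α} {V : Finset ℝ} {w : ℝ → ℝ} {A : ℝ → Finset α}
    (hA : ∀ v ∈ V, A v ⊆ S) (h : α → ℝ) :
    ∑ p ∈ S, h p * layerSum V w A p = ∑ v ∈ V, w v * ∑ p ∈ A v, h p := by
  simp only [layerSum, Finset.mul_sum]
  rw [Finset.sum_comm]
  refine Finset.sum_congr rfl fun v hv => ?_
  simp only [mul_ite, mul_zero, Finset.sum_ite_mem, Finset.inter_eq_right.2 (hA v hv)]
  exact Finset.sum_congr rfl fun p _ => mul_comm _ _

/-- The adjacency kernel yields the edge form, the identity kernel the square sum. -/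
theorem sum_kernel_layerSum {S : Finset α} {V : Finset ℝ} {w : ℝ → ℝ} {A : ℝ → Finset α}
    (hA : ∀ v ∈ V, A v ⊆ S) (K : α → α → ℝ) :
    ∑ p ∈ S, ∑ q ∈ S, K p q * (layerSum V w A p * layerSum V w A q) =
      ∑ v ∈ V, ∑ u ∈ V, w v * w u * ∑ p ∈ A v, ∑ q ∈ A u, K p q := by
  have h1 : ∀ p ∈ S, ∑ q ∈ S, K p q * (layerSum V w A p * layerSum V w A q) =
      (∑ u ∈ V, w u * ∑ q ∈ A u, K p q) * layerSum V w A p := by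
    intro p _
    rw [← sum_mul_layerSum hA (K p), Finset.sum_mul]
    exact Finset.sum_congr rfl fun q _ => by ring
  rw [Finset.sum_congr rfl h1, sum_mul_layerSum hA]
  refine Finset.sum_congr rfl fun v _ => ?_
  rw [Finset.sum_comm, Finset.mul_sum]
  refine Finset.sum_congr rfl fun u _ => ?_
  rw [← Finset.mul_sum, mul_assoc]

theorem sum_sq_layerSum {S : Finset α} {V : Finset ℝ} {w : ℝ → ℝ} {A : ℝ → Finset α}
    (hA : ∀ v ∈ V, A v ⊆ S) :
    ∑ p ∈ S, layerSum V w A p ^ 2 =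
      ∑ v ∈ V, ∑ u ∈ V, w v * w u * ((A v ∩ A u).card : ℝ) := by
  have h := sum_kernel_layerSum (w := w) hA (fun p q => if p = q then 1 else 0)
  simp only [ite_mul, one_mul, zero_mul, Finset.sum_ite_eq, Finset.sum_boole,
    Finset.filter_mem_eq_inter] at h
  rw [← h]
  exact Finset.sum_congr rfl fun p hp => by rw [if_pos hp, sq]

end Layers

theorem edgeForm_layerSum {S : Finset (ℤ × ℤ)} {V : Finset ℝ} {w : ℝ → ℝ}
    {A : ℝ → Finset (ℤ × ℤ)} (hA : ∀ v ∈ V, A v ⊆ S) :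
    edgeForm S (layerSum V w A) =
      ∑ v ∈ V, ∑ u ∈ V, w v * w u * (adjacentPairs (A v) (A u) : ℝ) := by
  rw [edgeForm, sum_kernel_layerSum hA]
  simp only [adjacentPairs, Nat.cast_sum, Nat.cast_ite, Nat.cast_one, Nat.cast_zero]

theorem edgeForm_congr {S : Finset (ℤ × ℤ)} {f g : ℤ × ℤ → ℝ} (h : ∀ p ∈ S, f p = g p) :
    edgeForm S f = edgeForm S g :=
  Finset.sum_congr rfl fun p hp => Finset.sum_congr rfl fun q hq => by rw [h p hp, h q hq]

/-- If a row of `G` has a gap, symmetrizing a function that is positive on `G` strictly increases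
its edge form. -/
theorem exists_edgeForm_lt_steinerSymm {G : Finset (ℤ × ℤ)} {f : ℤ × ℤ → ℝ}
    (hf : ∀ p ∈ G, 0 < f p) {a b c j : ℤ} (ha : (a, j) ∈ G) (hb : (b, j) ∈ G)
    (hac : a ≤ c) (hcb : c ≤ b) (hc : (c, j) ∉ G) :
    ∃ g : ℤ × ℤ → ℝ, ∑ p ∈ steinerSymm G, g p ^ 2 = ∑ p ∈ G, f p ^ 2 ∧
      edgeForm G f < edgeForm (steinerSymm G) g := by
  have hVpos : ∀ v ∈ G.image f, 0 < v := by
    intro v hv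
    obtain ⟨p, hp, rfl⟩ := Finset.mem_image.1 hv
    exact hf p hp
  obtain ⟨w, hw, hsum⟩ := exists_pos_increments (G.image f) hVpos
  set V := G.image f with hV
  let A : ℝ → Finset (ℤ × ℤ) := fun v => G.filter (v ≤ f ·)
  have hAG : ∀ v ∈ V, A v ⊆ G := fun v _ => Finset.filter_subset _ _
  have hA'G : ∀ v ∈ V, steinerSymm (A v) ⊆ steinerSymm G := fun v hv =>
    steinerSymm_mono (hAG v hv)
  have hanti : ∀ {u v}, u ≤ v → A v ⊆ A u := fun {u v} h p hp => by
    simp only [A, Finset.mem_filter] at *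
    exact ⟨hp.1, h.trans hp.2⟩
  have hfeq : ∀ p ∈ G, f p = layerSum V w A p := by
    intro p hp
    rw [hsum (f p) (Finset.mem_image_of_mem _ hp), layerSum]
    refine Finset.sum_congr rfl fun v _ => ?_
    simp [A, hp]
  have hVne : V.Nonempty := ⟨f (a, j), Finset.mem_image_of_mem _ ha⟩
  -- The lowest layer is all of `G`, so the gap gives one strict term, with positive weight.
  have hmin : A (V.min' hVne) = G :=
    Finset.filter_true_of_mem fun p hp => V.min'_le _ (Finset.mem_image_of_mem _ hp)
  have hle : ∀ u v, adjacentPairs (A v) (A u) ≤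
      adjacentPairs (steinerSymm (A v)) (steinerSymm (A u)) := by
    intro u v
    rcases le_total u v with h | h
    · exact adjacentPairs_le_steinerSymm_of_subset (hanti h)
    · rw [adjacentPairs_comm, adjacentPairs_comm (steinerSymm (A v))]
      exact adjacentPairs_le_steinerSymm_of_subset (hanti h)
  refine ⟨layerSum V w fun v => steinerSymm (A v), ?_, ?_⟩
  · rw [Finset.sum_congr rfl fun p hp => congrArg (· ^ 2) (hfeq p hp), sum_sq_layerSum hA'G,
      sum_sq_layerSum hAG]
    refine Finset.sum_congr rfl fun v _ => Finset.sum_congr rfl fun u _ => ?_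
    congr 2
    rcases le_total u v with h | h
    · rw [Finset.inter_eq_left.2 (hanti h), Finset.inter_eq_left.2 (steinerSymm_mono (hanti h)),
        card_steinerSymm]
    · rw [Finset.inter_eq_right.2 (hanti h), Finset.inter_eq_right.2 (steinerSymm_mono (hanti h)),
        card_steinerSymm]
  · rw [edgeForm_congr hfeq, edgeForm_layerSum hA'G, edgeForm_layerSum hAG]
    have hterm : ∀ v ∈ V, ∀ u ∈ V, w v * w u * (adjacentPairs (A v) (A u) : ℝ) ≤
        w v * w u * (adjacentPairs (steinerSymm (A v)) (steinerSymm (A u)) : ℝ) := by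
      intro v hv u hu
      exact mul_le_mul_of_nonneg_left (by exact_mod_cast hle u v)
        (mul_pos (hw v hv) (hw u hu)).le
    have hm := V.min'_mem hVne
    refine Finset.sum_lt_sum (fun v hv => Finset.sum_le_sum (hterm v hv))
      ⟨_, hm, Finset.sum_lt_sum (hterm _ hm) ⟨_, hm, ?_⟩⟩
    rw [hmin]
    exact mul_lt_mul_of_pos_left
      (by exact_mod_cast adjacentPairs_self_lt_steinerSymm ha hb hac hcb hc)
      (mul_pos (hw _ hm) (hw _ hm))

/-! ### Strictness, positivity and crossing edges -/

/-- If `Λ` bounds the Rayleigh quotients of all subgraphs with at most `N` vertices, the bound is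
strict for positive functions on fewer than `N` vertices. -/
theorem edgeForm_lt_of_card_lt {N : ℕ} {Λ : ℝ}
    (hΛ : ∀ (S : Finset (ℤ × ℤ)) (f : ℤ × ℤ → ℝ), S.card ≤ N →
      edgeForm S f ≤ Λ * ∑ p ∈ S, f p ^ 2)
    {S : Finset (ℤ × ℤ)} (hS : S.Nonempty) (hcard : S.card < N) {f : ℤ × ℤ → ℝ}
    (hf : ∀ p ∈ S, 0 < f p) : edgeForm S f < Λ * ∑ p ∈ S, f p ^ 2 := by
  obtain ⟨p, hp, hpmax⟩ := S.exists_max_image Prod.fst hS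
  set v : ℤ × ℤ := (p.1 + 1, p.2) with hv
  have hvS : v ∉ S := fun h => by have := hpmax v h; simp [hv] at this
  have hadj : squareLattice.Adj p v := squareLattice_adj_iff.2 (Or.inl rfl)
  have hne : ∀ q ∈ S, q ≠ v := fun q hq h => hvS (h ▸ hq)
  -- With this `ε` the linear gain `2 * ε * f p` from the edge to `v` exceeds the quadratic cost `Λ
  -- * ε ^ 2`.
  set ε : ℝ := f p / (|Λ| + 1) with hε
  have hL : 0 < |Λ| + 1 := by positivity
  have hεpos : 0 < ε := div_pos (hf p hp) hL
  set g := Function.update f v ε with hg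
  have hgv : g v = ε := Function.update_self _ _ _
  have hgS : ∀ q ∈ S, g q = f q := fun q hq => Function.update_of_ne (hne q hq) _ _
  have hb := hΛ (insert v S) g (by rw [Finset.card_insert_of_notMem hvS]; exact hcard)
  rw [Finset.sum_insert hvS, Finset.sum_congr rfl fun q hq => congrArg (· ^ 2) (hgS q hq),
    hgv] at hb
  have hexp : edgeForm (insert v S) g =
      ∑ q ∈ S, (if squareLattice.Adj v q then 1 else 0) * (ε * f q) +
      (∑ q ∈ S, (if squareLattice.Adj q v then 1 else 0) * (f q * ε) + edgeForm S f) := by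
    rw [← edgeForm_congr hgS, edgeForm, Finset.sum_insert hvS, Finset.sum_insert hvS,
      if_neg (squareLattice.loopless.irrefl v), zero_mul, zero_add, hgv]
    congr 1
    · exact Finset.sum_congr rfl fun q hq => by rw [hgS q hq]
    · rw [edgeForm, ← Finset.sum_add_distrib]
      refine Finset.sum_congr rfl fun q hq => ?_
      rw [Finset.sum_insert hvS, hgv, hgS q hq]
  have h1 : ε * f p ≤ ∑ q ∈ S, (if squareLattice.Adj v q then 1 else 0) * (ε * f q) := by
    have := Finset.single_le_sum
      (f := fun q => (if squareLattice.Adj v q then (1 : ℝ) else 0) * (ε * f q))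
      (fun q hq => mul_nonneg (by split_ifs <;> norm_num) (mul_pos hεpos (hf q hq)).le) hp
    simpa [hadj.symm] using this
  have h2 : f p * ε ≤ ∑ q ∈ S, (if squareLattice.Adj q v then 1 else 0) * (f q * ε) := by
    have := Finset.single_le_sum
      (f := fun q => (if squareLattice.Adj q v then (1 : ℝ) else 0) * (f q * ε))
      (fun q hq => mul_nonneg (by split_ifs <;> norm_num) (mul_pos (hf q hq) hεpos).le) hp
    simpa [hadj] using this
  have h3 : Λ * ε ^ 2 < 2 * (ε * f p) := by
    have hfp : f p = ε * (|Λ| + 1) := by rw [hε]; field_simp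
    have : Λ ≤ |Λ| := le_abs_self Λ
    have : 0 ≤ |Λ| := abs_nonneg Λ
    have : 0 < ε ^ 2 := by positivity
    rw [hfp]
    nlinarith
  linarith

/-- A positive maximizer couples the vertices in rows `≤ j` with the ones above. -/
theorem exists_adjacent_rows {G : Finset (ℤ × ℤ)} {Λ : ℝ}
    (hΛ : ∀ (S : Finset (ℤ × ℤ)) (f : ℤ × ℤ → ℝ), S.card ≤ G.card →
      edgeForm S f ≤ Λ * ∑ p ∈ S, f p ^ 2) {f : ℤ × ℤ → ℝ} (hf : ∀ p ∈ G, 0 < f p)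
    (heq : edgeForm G f = Λ * ∑ p ∈ G, f p ^ 2) {p q : ℤ × ℤ} (hp : p ∈ G) (hq : q ∈ G) {j : ℤ}
    (hpj : p.2 ≤ j) (hjq : j < q.2) : ∃ i, (i, j) ∈ G ∧ (i, j + 1) ∈ G := by
  -- Without a crossing edge the form splits over two nonempty proper parts, each strictly below the
  -- bound.
  by_contra! hno
  set S := G.filter (·.2 ≤ j) with hS
  set T := G.filter (fun x => ¬ x.2 ≤ j) with hT
  have hSlt : S.card < G.card :=
    Finset.card_filter_lt_of_exists_not ⟨q, hq, not_le.2 hjq⟩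
  have hTlt : T.card < G.card :=
    Finset.card_filter_lt_of_exists_not ⟨p, hp, not_not.2 hpj⟩
  have h1 := edgeForm_lt_of_card_lt hΛ ⟨p, Finset.mem_filter.2 ⟨hp, hpj⟩⟩ hSlt
    fun x hx => hf x (Finset.mem_filter.1 hx).1
  have h2 := edgeForm_lt_of_card_lt hΛ ⟨q, Finset.mem_filter.2 ⟨hq, not_le.2 hjq⟩⟩ hTlt
    fun x hx => hf x (Finset.mem_filter.1 hx).1
  have hcross : ∀ x ∈ S, ∀ y ∈ T, ¬ squareLattice.Adj x y := by
    rintro ⟨a, b⟩ hx ⟨c, d⟩ hy hadj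
    obtain ⟨hxG, hb⟩ := Finset.mem_filter.1 hx
    obtain ⟨hyG, hd⟩ := Finset.mem_filter.1 hy
    rw [squareLattice_adj_iff] at hadj
    simp only [Prod.mk.injEq] at hadj hb hd
    obtain rfl : b = j := by omega
    obtain rfl : c = a := by omega
    obtain rfl : d = b + 1 := by omega
    exact hno _ hxG hyG
  have hsplit : edgeForm G f = edgeForm S f + edgeForm T f := by
    rw [edgeForm, ← Finset.sum_filter_add_sum_filter_not G (·.2 ≤ j), edgeForm, edgeForm]
    congr 1
    · refine Finset.sum_congr rfl fun x hx => ?_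
      rw [← Finset.sum_filter_add_sum_filter_not G (·.2 ≤ j), add_eq_left]
      exact Finset.sum_eq_zero fun y hy => by rw [if_neg (hcross x hx y hy), zero_mul]
    · refine Finset.sum_congr rfl fun x hx => ?_
      rw [← Finset.sum_filter_add_sum_filter_not G (·.2 ≤ j), add_eq_right]
      exact Finset.sum_eq_zero fun y hy => by
        rw [if_neg fun h => hcross y hy x hx h.symm, zero_mul]
  have hsq := Finset.sum_filter_add_sum_filter_not G (·.2 ≤ j) (fun x => f x ^ 2)
  rw [← hS, ← hT] at hsq
  rw [hsplit, ← hsq] at heq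
  linarith

theorem edgeForm_filter_ne_zero (S : Finset (ℤ × ℤ)) (f : ℤ × ℤ → ℝ) :
    edgeForm (S.filter (f · ≠ 0)) f = edgeForm S f := by
  rw [edgeForm, edgeForm, Finset.sum_filter_of_ne]
  · exact Finset.sum_congr rfl fun p _ => Finset.sum_filter_of_ne fun q _ h h0 => h (by simp [h0])
  · intro p _ h h0
    exact h (Finset.sum_eq_zero fun q _ => by simp [h0])

/-- Dropping the zeros of `f` changes neither side of `heq`, so a zero in `G` would give equality on
a smaller set. -/
theorem pos_of_maximizer {G : Finset (ℤ × ℤ)} {Λ : ℝ}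
    (hΛ : ∀ (S : Finset (ℤ × ℤ)) (f : ℤ × ℤ → ℝ), S.card ≤ G.card →
      edgeForm S f ≤ Λ * ∑ p ∈ S, f p ^ 2) {f : ℤ × ℤ → ℝ} (hf : ∀ p, 0 ≤ f p)
    (hpos : 0 < ∑ p ∈ G, f p ^ 2) (heq : edgeForm G f = Λ * ∑ p ∈ G, f p ^ 2) :
    ∀ p ∈ G, 0 < f p := by
  by_contra! h
  obtain ⟨p, hp, hp0⟩ := h
  have hsq : ∑ p ∈ G.filter (f · ≠ 0), f p ^ 2 = ∑ p ∈ G, f p ^ 2 :=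
    Finset.sum_filter_of_ne fun q _ h h0 => h (by simp [h0])
  have hne : (G.filter (f · ≠ 0)).Nonempty := by
    rw [Finset.nonempty_iff_ne_empty]
    intro h0
    rw [h0, Finset.sum_empty] at hsq
    exact hpos.ne hsq
  have := edgeForm_lt_of_card_lt hΛ hne
    (Finset.card_filter_lt_of_exists_not ⟨p, hp, not_not.2 (le_antisymm hp0 (hf p))⟩)
    (fun q hq => (hf q).lt_of_ne' (Finset.mem_filter.1 hq).2)
  rw [edgeForm_filter_ne_zero, hsq] at this
  exact this.ne heq

/-! ### Variational characterization and conclusion -/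

theorem dotProduct_dirichletLaplacian_mulVec (G : Finset (ℤ × ℤ)) (f : ℤ × ℤ → ℝ) :
    (fun p : G => f p) ⬝ᵥ (dirichletLaplacian G).mulVec (fun p : G => f p) =
      4 * ∑ p ∈ G, f p ^ 2 - edgeForm G f := by
  rw [dirichletLaplacian, Matrix.sub_mulVec, Matrix.smul_mulVec, Matrix.one_mulVec,
    dotProduct_sub, dotProduct_smul, smul_eq_mul]
  congr 1
  · rw [dotProduct, ← Finset.sum_coe_sort G]
    simp only [sq]
  · rw [edgeForm, ← Finset.sum_coe_sort G, dotProduct]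
    refine Finset.sum_congr rfl fun p _ => ?_
    rw [← Finset.sum_coe_sort G, Matrix.mulVec, dotProduct, Finset.mul_sum]
    refine Finset.sum_congr rfl fun q _ => ?_
    simp only [SimpleGraph.adjMatrix_apply, SimpleGraph.comap_adj]
    split_ifs <;> ring

/-- Allows a maximizing eigenvector to be replaced by its absolute value. -/
theorem edgeForm_le_edgeForm_abs (S : Finset (ℤ × ℤ)) (f : ℤ × ℤ → ℝ) :
    edgeForm S f ≤ edgeForm S fun p => |f p| := by
  unfold edgeForm
  refine Finset.sum_le_sum fun p _ => Finset.sum_le_sum fun q _ =>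
    mul_le_mul_of_nonneg_left ?_ (by split_ifs <;> norm_num)
  rw [← abs_mul]
  exact le_abs_self _

/-- The variational characterization of the lowest Dirichlet eigenvalue. -/
theorem exists_maximizer_edgeForm {G : Finset (ℤ × ℤ)} (hne : G.Nonempty) :
    (∀ f : ℤ × ℤ → ℝ, edgeForm G f ≤ (4 - lamD G) * ∑ p ∈ G, f p ^ 2) ∧
    ∃ f : ℤ × ℤ → ℝ, (∀ p, 0 ≤ f p) ∧ 0 < ∑ p ∈ G, f p ^ 2 ∧
      edgeForm G f = (4 - lamD G) * ∑ p ∈ G, f p ^ 2 := by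
  classical
  set M := dirichletLaplacian G with hM
  have hherm : M.IsHermitian := by
    rw [hM, dirichletLaplacian, Matrix.IsHermitian, Matrix.conjTranspose_sub,
      Matrix.conjTranspose_smul, Matrix.conjTranspose_one,
      ((latticeSubgraph G).isHermitian_adjMatrix (R := ℝ)).eq]
    simp
  have hset : {μ : ℝ | Module.End.HasEigenvalue (Matrix.toLin' M) μ} = spectrum ℝ M := by
    ext μ
    rw [Set.mem_ofPred_eq, Module.End.hasEigenvalue_iff_mem_spectrum, Matrix.spectrum_toLin']
  have hfin : (spectrum ℝ M).Finite := by
    rw [hherm.spectrum_real_eq_range_eigenvalues]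
    exact Set.finite_range _
  have hnon : (spectrum ℝ M).Nonempty := by
    rw [hherm.spectrum_real_eq_range_eigenvalues]
    have : Nonempty G := hne.to_subtype
    exact Set.range_nonempty _
  have hlam : lamD G = sInf (spectrum ℝ M) := by rw [lamD, ← hM, hset]
  have hmem : lamD G ∈ spectrum ℝ M := hlam ▸ hnon.csInf_mem hfin
  have hpsd : (M - algebraMap ℝ _ (lamD G)).PosSemidef := by
    rw [Matrix.posSemidef_iff_isHermitian_and_spectrum_nonneg]
    refine ⟨hherm.sub ?_, ?_⟩
    · rw [Matrix.algebraMap_eq_diagonal]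
      exact Matrix.isHermitian_diagonal _
    · intro μ hμ
      rw [← spectrum.sub_singleton_eq] at hμ
      obtain ⟨a, ha, b, rfl, rfl⟩ := hμ
      have := csInf_le hfin.bddBelow ha
      rw [← hlam] at this
      exact sub_nonneg.2 this
  have hbound : ∀ f : ℤ × ℤ → ℝ, edgeForm G f ≤ (4 - lamD G) * ∑ p ∈ G, f p ^ 2 := by
    intro f
    have h := hpsd.dotProduct_mulVec_nonneg (fun p : G => f p)
    rw [Matrix.sub_mulVec, dotProduct_sub, star_trivial,
      dotProduct_dirichletLaplacian_mulVec, Algebra.algebraMap_eq_smul_one, Matrix.smul_mulVec,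
      Matrix.one_mulVec, dotProduct_smul, smul_eq_mul, dotProduct,
      Finset.sum_coe_sort G (fun p => f p * f p)] at h
    simp only [← sq] at h
    linarith
  refine ⟨hbound, ?_⟩
  rw [← hset] at hmem
  obtain ⟨x, hx⟩ := hmem.exists_hasEigenvector
  let f : ℤ × ℤ → ℝ := fun p => if h : p ∈ G then x ⟨p, h⟩ else 0
  have hfx : (fun p : G => f p) = x := by
    ext p
    simp [f]
  have hfeq : edgeForm G f = (4 - lamD G) * ∑ p ∈ G, f p ^ 2 := by
    have h := dotProduct_dirichletLaplacian_mulVec G f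
    have hx1 := hx.apply_eq_smul
    rw [Matrix.toLin'_apply] at hx1
    rw [hfx, ← hM, hx1, dotProduct_smul, ← hfx, smul_eq_mul, dotProduct,
      Finset.sum_coe_sort G (fun p => f p * f p)] at h
    simp only [← sq] at h
    linarith
  have hsq : ∑ p ∈ G, |f p| ^ 2 = ∑ p ∈ G, f p ^ 2 := by simp only [sq_abs]
  refine ⟨fun p => |f p|, fun p => abs_nonneg _, ?_, le_antisymm (hbound _) ?_⟩
  · rw [hsq]
    obtain ⟨p, hp⟩ := Function.ne_iff.1 hx.2
    refine Finset.sum_pos' (fun _ _ => sq_nonneg _) ⟨p, p.2, ?_⟩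
    rw [← hfx] at hp
    simpa only [sq_abs] using pow_pos (abs_pos.2 hp) 2
  · rw [hsq, ← hfeq]
    exact edgeForm_le_edgeForm_abs G f

/-- A crude bound, needed so that the infimum in `lamDInf` is over a set bounded below. -/
theorem edgeForm_le_card_mul (S : Finset (ℤ × ℤ)) (f : ℤ × ℤ → ℝ) :
    edgeForm S f ≤ S.card * ∑ p ∈ S, f p ^ 2 := by
  have h : edgeForm S f ≤ ∑ p ∈ S, ∑ q ∈ S, (f p ^ 2 + f q ^ 2) / 2 := by
    unfold edgeForm
    gcongr with p _ q _
    split_ifs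
    · nlinarith [sq_nonneg (f p - f q)]
    · rw [zero_mul]; positivity
  refine h.trans (le_of_eq ?_)
  simp only [← Finset.sum_div, Finset.sum_add_distrib, Finset.sum_const, nsmul_eq_mul,
    ← Finset.mul_sum]
  ring

/-- A minimizing subgraph maximizes the edge form among all subgraphs with at most as many
vertices. -/
theorem IsMinimizingSubgraph.edgeForm_le {G : Finset (ℤ × ℤ)} (hG : IsMinimizingSubgraph G)
    (hne : G.Nonempty) (S : Finset (ℤ × ℤ)) (f : ℤ × ℤ → ℝ) (hS : S.card ≤ G.card) :
    edgeForm S f ≤ (4 - lamD G) * ∑ p ∈ S, f p ^ 2 := by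
  -- Pad `S` to exactly `G.card` vertices and extend `f` by zero.
  obtain ⟨T, hST, hT⟩ := Infinite.exists_superset_card_eq S G.card hS
  have hnonempty : ∀ H : Finset (ℤ × ℤ), H.card = G.card → H.Nonempty := fun H h =>
    Finset.card_pos.1 (h ▸ hne.card_pos)
  have hbdd : BddBelow {r : ℝ | ∃ H : Finset (ℤ × ℤ), H.card = G.card ∧ lamD H = r} := by
    refine ⟨4 - G.card, ?_⟩
    rintro _ ⟨H, hH, rfl⟩
    obtain ⟨-, f, -, hpos, heq⟩ := exists_maximizer_edgeForm (hnonempty H hH)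
    have := edgeForm_le_card_mul H f
    rw [heq, hH] at this
    have := le_of_mul_le_mul_right this hpos
    linarith
  have hle : lamD G ≤ lamD T := by
    rw [show lamD G = lamDInf G.card from hG]
    exact csInf_le hbdd ⟨T, hT, rfl⟩
  let g : ℤ × ℤ → ℝ := fun p => if p ∈ S then f p else 0
  have hg : ∀ p ∈ S, g p = f p := fun p hp => if_pos hp
  have hg0 : ∀ p ∉ S, g p = 0 := fun p hp => if_neg hp
  have hform : edgeForm T g = edgeForm S f := by
    rw [← edgeForm_congr hg, edgeForm, edgeForm]
    symm
    rw [← Finset.sum_subset hST]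
    · refine Finset.sum_congr rfl fun p _ => Finset.sum_subset hST fun q _ hq => ?_
      simp [hg0 q hq]
    · intro p _ hp
      simp [hg0 p hp]
  have hsq : ∑ p ∈ T, g p ^ 2 = ∑ p ∈ S, f p ^ 2 := by
    rw [← Finset.sum_subset hST fun p _ hp => by simp [hg0 p hp]]
    exact Finset.sum_congr rfl fun p hp => by rw [hg p hp]
  have h := (exists_maximizer_edgeForm (hnonempty T hT)).1 g
  rw [hform, hsq] at h
  refine h.trans (mul_le_mul_of_nonneg_right (by linarith) ?_)
  exact Finset.sum_nonneg fun _ _ => sq_nonneg _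

theorem mainTheorem12 (G : Finset (ℤ × ℤ)) (hne : G.Nonempty) (hG : IsMinimizingSubgraph G) :
    IsSimplyConnected (associatedDomain G) := by
  have hΛ := hG.edgeForm_le hne
  obtain ⟨-, f, hf, hpos, heq⟩ := exists_maximizer_edgeForm hne
  have hfpos := pos_of_maximizer hΛ hf hpos heq
  refine isSimplyConnected_associatedDomain hne ?_ fun p hp q hq j hpj hjq =>
    exists_adjacent_rows hΛ hfpos heq hp hq hpj hjq
  intro a b c j ha hb hac hcb
  by_contra hc
  obtain ⟨g, hg, hlt⟩ := exists_edgeForm_lt_steinerSymm hfpos ha hb hac hcb hc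
  have h := hΛ (steinerSymm G) g (card_steinerSymm G).le
  rw [hg, ← heq] at h
  exact hlt.not_ge h
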